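/- Let $A \supset P$ be an inclusion of unital $C^*$-algebras (with common unit) and let $E\colon A\to P$ be a conditional expectation onto $P$ (a positive $P$-bimodular linear contraction restricting to the identity on $P$). Assume that $E$ has finite Watatani index, i.e. there is a finite family $(u_i,v_i)_{i=1}^n$ in $A\times A$ (a quasi-basis) with $a=\sum_i u_iE(v_ia)=\sum_i E(au_i)v_i$ for all $a\in A$; put $\mathrm{Index}\,E=\sum_i u_iv_i$, which does not depend on the quasi-basis. Let $A^\infty=\ell^\infty(\mathbb N,A)/c_0(A)$, where $c_0(A)$ is the ideal of norm-null sequences; identify $A$ with the classes of constant sequences, let $A_\infty=A^\infty\cap A'$, and let $E^\infty$ be the map induced by $E$ on $A^\infty$. Assume that $E$ has the Rohlin property: there is a projection $e\in A_\infty$ with $E^\infty(e)=(\mathrm{Index}\,E)^{-1}$ and such that the map $A\ni x\mapsto xe\in A^\infty$ is injective. If $A$ is simple (that is, $A\neq 0$ and $A$ has no closed two-sided ideals other than $0$ and $A$), then the inclusion $A\supset P$ is irreducible, i.e. $P'\cap A=\mathbb C1$, and $P$ is simple. -/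

import Mathlib

open Filter Topology
open scoped BoundedContinuousFunction

noncomputable section

namespace CStarInclusion

/-! ### Conditional expectations, quasi-bases and the Watatani index -/

section Index

variable {A : Type*} [CStarAlgebra A]

/-- A conditional expectation from a unital C⋆-algebra `A` onto a unital C⋆-subalgebra `P`: a
positive linear contraction `A → P` which restricts to the identity on `P` and is
`P`-bimodular. It is regarded as a map `A → A` with values in `P`. Positivity is expressed by saying
that elements of the form `a⋆a` are mapped to elements of the form `b⋆b`. -/
structure ConditionalExpectation (P : StarSubalgebra ℂ A) where
  toLinearMap : A →ₗ[ℂ] A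
  map_mem : ∀ a, toLinearMap a ∈ P
  map_of_mem : ∀ p ∈ P, toLinearMap p = p
  map_mul_left : ∀ p ∈ P, ∀ a, toLinearMap (p * a) = p * toLinearMap a
  map_mul_right : ∀ p ∈ P, ∀ a, toLinearMap (a * p) = toLinearMap a * p
  map_nonneg : ∀ a, ∃ b, toLinearMap (star a * a) = star b * b
  norm_map_le : ∀ a, ‖toLinearMap a‖ ≤ ‖a‖

namespace ConditionalExpectation

variable {P : StarSubalgebra ℂ A}

instance : CoeFun (ConditionalExpectation P) (fun _ => A → A) := ⟨fun E => E.toLinearMap⟩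

/-- A conditional expectation as a bounded linear map `A → A`. -/
def toCLM (E : ConditionalExpectation P) : A →L[ℂ] A :=
  E.toLinearMap.mkContinuous 1 (fun a => by simpa using E.norm_map_le a)

@[simp] theorem toCLM_apply (E : ConditionalExpectation P) (a : A) : E.toCLM a = E a := rfl

/-- `{(u i, v i)}` is a quasi-basis for `E`. -/
def IsQuasiBasis (E : ConditionalExpectation P) {n : ℕ} (u v : Fin n → A) : Prop :=
  ∀ a, a = ∑ i, u i * E (v i * a) ∧ a = ∑ i, E (a * u i) * v i

/-- `E` has finite (Watatani) index: it admits a quasi-basis. -/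
def FiniteIndex (E : ConditionalExpectation P) : Prop :=
  ∃ (n : ℕ) (u v : Fin n → A), E.IsQuasiBasis u v

/-- The Watatani index `∑ i, u i * v i` of a conditional expectation with finite index, computed
with any quasi-basis (see `index_eq`). -/
def index (E : ConditionalExpectation P) (hE : E.FiniteIndex) : A :=
  ∑ i, hE.choose_spec.choose i * hE.choose_spec.choose_spec.choose i

/-- The value of `∑ i, u i * v i` is the same for all quasi-bases. -/
theorem IsQuasiBasis.sum_eq {E : ConditionalExpectation P} {n m : ℕ} {u v : Fin n → A}
    {x y : Fin m → A} (h : E.IsQuasiBasis u v) (h' : E.IsQuasiBasis x y) :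
    ∑ i, u i * v i = ∑ j, x j * y j := by
  calc ∑ i, u i * v i = ∑ i, u i * ∑ j, E (v i * x j) * y j :=
        Finset.sum_congr rfl fun i _ => by rw [← (h' (v i)).2]
    _ = ∑ j, (∑ i, u i * E (v i * x j)) * y j := by
        simp only [Finset.mul_sum, Finset.sum_mul, mul_assoc]
        exact Finset.sum_comm
    _ = ∑ j, x j * y j := Finset.sum_congr rfl fun j _ => by rw [← (h (x j)).1]

theorem index_eq {E : ConditionalExpectation P} (hE : E.FiniteIndex) {n : ℕ} {u v : Fin n → A}
    (h : E.IsQuasiBasis u v) : E.index hE = ∑ i, u i * v i :=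
  IsQuasiBasis.sum_eq hE.choose_spec.choose_spec.choose_spec h

end ConditionalExpectation

end Index

/-! ### The sequence algebra `A^∞ = ℓ^∞(ℕ, A) / c₀(A)` -/

section SequenceAlgebra

variable (A : Type*) [CStarAlgebra A]

/-- The ideal `c₀(A)` of norm-null sequences in `ℓ^∞(ℕ, A)`, the C⋆-algebra of all bounded
sequences in `A`; the latter is realised as `ℕ →ᵇ A` (`ℕ` is discrete). -/
def nullSeq : Ideal (ℕ →ᵇ A) where
  carrier := {a | Tendsto (fun n => ‖a n‖) atTop (𝓝 0)}
  zero_mem' := by simp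
  add_mem' := by
    intro a b ha hb
    simp only [Set.mem_ofPred_eq, ← tendsto_zero_iff_norm_tendsto_zero] at *
    rw [← add_zero (0 : A)]
    exact ha.add hb
  smul_mem' := by
    intro c a ha
    simp only [Set.mem_ofPred_eq] at *
    refine squeeze_zero (fun n => norm_nonneg _) (fun n => ?_)
      (by simpa using ha.const_mul ‖c‖)
    exact (norm_mul_le (c n) (a n)).trans
      (mul_le_mul_of_nonneg_right (c.norm_coe_le_norm n) (norm_nonneg _))

variable {A}

theorem mem_nullSeq {a : ℕ →ᵇ A} : a ∈ nullSeq A ↔ Tendsto (fun n => ‖a n‖) atTop (𝓝 0) :=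
  Iff.rfl

instance : (nullSeq A).IsTwoSided where
  mul_mem_of_left := by
    intro a b ha
    rw [mem_nullSeq] at *
    refine squeeze_zero (fun n => norm_nonneg _) (fun n => ?_)
      (by simpa using ha.mul_const ‖b‖)
    exact (norm_mul_le (a n) (b n)).trans
      (mul_le_mul_of_nonneg_left (b.norm_coe_le_norm n) (norm_nonneg _))

theorem star_mem_nullSeq {a : ℕ →ᵇ A} (ha : a ∈ nullSeq A) : star a ∈ nullSeq A := by
  rw [mem_nullSeq] at *
  simpa using ha

variable (A) in
/-- `A^∞ = ℓ^∞(ℕ, A) / c₀(A)`, as a unital ⋆-algebra over `ℂ`. -/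
abbrev SeqAlg : Type _ := (ℕ →ᵇ A) ⧸ nullSeq A

/-- The class in `A^∞` of a bounded sequence in `A`. -/
abbrev SeqAlg.mk (a : ℕ →ᵇ A) : SeqAlg A := Ideal.Quotient.mk (nullSeq A) a

/-- The involution of `A^∞`, induced by the pointwise involution of sequences. -/
instance : Star (SeqAlg A) where
  star := Quotient.map' star (fun a b h => by
    rw [Submodule.quotientRel_def] at h ⊢
    simpa using star_mem_nullSeq h)

@[simp] theorem SeqAlg.star_mk (a : ℕ →ᵇ A) : star (SeqAlg.mk a) = SeqAlg.mk (star a) := rfl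

instance : StarRing (SeqAlg A) where
  star_involutive x := by
    obtain ⟨a, rfl⟩ := Ideal.Quotient.mk_surjective x
    simp
  star_mul x y := by
    obtain ⟨a, rfl⟩ := Ideal.Quotient.mk_surjective x
    obtain ⟨b, rfl⟩ := Ideal.Quotient.mk_surjective y
    rw [← map_mul, SeqAlg.star_mk, SeqAlg.star_mk, SeqAlg.star_mk, star_mul]
    exact map_mul (Ideal.Quotient.mk (nullSeq A)) _ _
  star_add x y := by
    obtain ⟨a, rfl⟩ := Ideal.Quotient.mk_surjective x
    obtain ⟨b, rfl⟩ := Ideal.Quotient.mk_surjective y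
    rw [← map_add, SeqAlg.star_mk, SeqAlg.star_mk, SeqAlg.star_mk, star_add]
    exact map_add (Ideal.Quotient.mk (nullSeq A)) _ _

/-- The embedding `A → A^∞` as (classes of) constant sequences. -/
def constSeq (a : A) : SeqAlg A := SeqAlg.mk (BoundedContinuousFunction.const ℕ a)

variable (A) in
/-- `A_∞ = A^∞ ∩ A'`, the commutant of the constant sequences in `A^∞`. -/
def centralSeq : Set (SeqAlg A) := Set.centralizer (Set.range (constSeq (A := A)))

/-- The linear map `A^∞ → A^∞` induced by a bounded linear map `T : A → A`, that is
`[(a_n)] ↦ [(T a_n)]`. -/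
def seqMap (T : A →L[ℂ] A) : SeqAlg A →ₗ[ℂ] SeqAlg A where
  toFun := Quotient.map' (T.compLeftContinuousBounded ℕ) (fun a b h => by
    rw [Submodule.quotientRel_def] at h ⊢
    rw [← map_sub, mem_nullSeq, ← tendsto_zero_iff_norm_tendsto_zero]
    rw [mem_nullSeq, ← tendsto_zero_iff_norm_tendsto_zero] at h
    rw [← map_zero T]
    exact (T.continuous.tendsto 0).comp h)
  map_add' x y := by
    obtain ⟨a, rfl⟩ := Ideal.Quotient.mk_surjective x
    obtain ⟨b, rfl⟩ := Ideal.Quotient.mk_surjective y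
    exact congrArg SeqAlg.mk (map_add (T.compLeftContinuousBounded ℕ) a b)
  map_smul' c x := by
    obtain ⟨a, rfl⟩ := Ideal.Quotient.mk_surjective x
    exact congrArg SeqAlg.mk (map_smul (T.compLeftContinuousBounded ℕ) c a)

@[simp] theorem seqMap_mk (T : A →L[ℂ] A) (a : ℕ →ᵇ A) :
    seqMap T (SeqAlg.mk a) = SeqAlg.mk (T.compLeftContinuousBounded ℕ a) := rfl

end SequenceAlgebra

/-! ### The Rohlin property, irreducibility and simplicity -/

section Rohlin

variable {A : Type*} [CStarAlgebra A] {P : StarSubalgebra ℂ A}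

/-- `E^∞ : A^∞ → P^∞ ⊆ A^∞`, induced by the conditional expectation `E`. -/
def ConditionalExpectation.seq (E : ConditionalExpectation P) :
    SeqAlg A →ₗ[ℂ] SeqAlg A := seqMap E.toCLM

/-- `E`, of finite index, has the Rohlin property: there is a projection `e ∈ A_∞` with
`E^∞(e) = (Index E)⁻¹` such that `x ↦ x e` is injective on `A`. Here `(Index E)⁻¹` is the genuine
inverse in `A`: the unit `w` is `Index E`. -/
def ConditionalExpectation.HasRohlinProperty (E : ConditionalExpectation P)
    (hE : E.FiniteIndex) : Prop :=
  ∃ e ∈ centralSeq A, IsStarProjection e ∧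
    (∃ w : Aˣ, (w : A) = E.index hE ∧ E.seq e = constSeq ((w⁻¹ : Aˣ) : A)) ∧
    Function.Injective (fun x : A => constSeq x * e)

/-- The inclusion `A ⊇ P` is irreducible: `P' ∩ A = ℂ 1`. -/
def IsIrreducibleInclusion (P : StarSubalgebra ℂ A) : Prop :=
  Set.centralizer (P : Set A) = Set.range (algebraMap ℂ A)

/-- Simplicity of a C⋆-algebra: it is nonzero and its only closed two-sided ideals are `0` and
the whole algebra. -/
def IsSimpleCStar (B : Type*) [Ring B] [TopologicalSpace B] : Prop :=
  Nontrivial B ∧ ∀ I : TwoSidedIdeal B, IsClosed (I : Set B) → I = ⊥ ∨ I = ⊤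

end Rohlin

end CStarInclusion

end

noncomputable section

namespace CStarInclusion

/-! ### Sums of squares and positive matrices in C⋆-algebras -/

section Positivity

variable {A : Type*} [CStarAlgebra A] {ι : Type*} [Fintype ι]

/-! The index is central, hence a nonzero scalar `c` since `A` is simple. Choose a quasi-basis `(wᵢ,
wᵢ⋆)` (`IsQuasiBasis.exists_star`) and put `dᵢ = wᵢ⋆ e - c̄ E^∞(wᵢ⋆ e) e`. The four terms of `∑ dᵢ⋆
dᵢ` cancel, so every `dᵢ` vanishes, which gives `e x = c e E^∞(e x)` on all of `A^∞`
(`IsQuasiBasis.proj_mul_eq`).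

It follows that `ρ(x) = c E^∞(x e)` satisfies `x e = e ρ(x)`, is multiplicative, takes values in the
range of `E^∞`, and is the constant embedding on `P`.

Irreducibility: `x ∈ P' ∩ A` commutes with every `ρ(a)`, so `a x e = x a e`; injectivity of `x ↦ x
e` makes `x` central, hence scalar.

Simplicity: for a nonzero closed ideal `I` of `P`, the `x` such that `ρ(x)` is represented by a
sequence in `I` form an ideal of `A` containing `I`, hence containing `1`. As `ρ(1) = 1`, some
sequence in `I` tends to `1`, so `1 ∈ I`. -/

theorem norm_sq_le_norm_sum_star_mul_self (c : ι → A) (i : ι) :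
    ‖c i‖ ^ 2 ≤ ‖∑ j, star (c j) * c j‖ := by
  let _ := CStarAlgebra.spectralOrder A
  let _ := CStarAlgebra.spectralOrderedRing A
  rw [pow_two, ← CStarRing.norm_star_mul_self]
  exact CStarAlgebra.norm_le_norm_of_nonneg_of_le (star_mul_self_nonneg _)
    (Finset.single_le_sum (f := fun j => star (c j) * c j)
      (fun j _ => star_mul_self_nonneg _) (Finset.mem_univ i))

theorem eq_zero_of_sum_star_mul_self_eq_zero {c : ι → A} (h : ∑ j, star (c j) * c j = 0) (i : ι) :
    c i = 0 := by
  have := norm_sq_le_norm_sum_star_mul_self c i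
  rw [h, norm_zero] at this
  exact norm_eq_zero.1 (pow_eq_zero_iff two_ne_zero |>.1 (this.antisymm (sq_nonneg _)))

/-- The negative part of a self-adjoint element `a`, and a square root of it. -/
theorem exists_negPart {a : A} (ha : IsSelfAdjoint a) :
    ∃ m s : A, star m = m ∧ m = star s * s ∧ m * a * m = -(star (s * m) * (s * m)) ∧
      (m = 0 → ∃ t : A, a = star t * t) := by
  let _ := CStarAlgebra.spectralOrder A
  let _ := CStarAlgebra.spectralOrderedRing A
  obtain ⟨s, hs⟩ := CStarAlgebra.nonneg_iff_eq_star_mul_self.1 (CFC.negPart_nonneg a)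
  have hm : star a⁻ = a⁻ := (CFC.negPart_nonneg a).isSelfAdjoint
  refine ⟨a⁻, s, hm, hs, ?_, fun h => CStarAlgebra.nonneg_iff_eq_star_mul_self.1
    ((CFC.negPart_eq_zero_iff a ha).1 h)⟩
  have h1 : a⁻ * a = -(a⁻ * a⁻) := by
    nth_rewrite 2 [← CFC.posPart_sub_negPart a ha]
    rw [mul_sub, CFC.negPart_mul_posPart, zero_sub]
  rw [h1, star_mul, hm, neg_mul, mul_assoc a⁻ (star s), ← mul_assoc (star s), ← hs, mul_assoc]

/-- A self-adjoint matrix over a C⋆-algebra `B ⊆ A` which is positive on the Hilbert module `B^n`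
is of the form `K K⋆`. -/
theorem exists_eq_sum_mul_star {B : Type*} [CStarAlgebra B] (φ : B →⋆ₐ[ℂ] A)
    (hφ : Function.Injective φ) (H : ι → ι → B) (hH : ∀ i j, star (H i j) = H j i)
    (hpos : ∀ x : ι → B, ∃ b : A, φ (∑ i, ∑ j, star (x i) * H i j * x j) = star b * b) :
    ∃ K : ι → ι → B, ∀ i j, H i j = ∑ k, K i k * star (K j k) := by
  classical
  let _ := CStarAlgebra.spectralOrder B
  let _ := CStarAlgebra.spectralOrderedRing B
  let M : CStarMatrix ι ι B := CStarMatrix.ofMatrix H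
  have hM : ∀ i j, M i j = H i j := fun _ _ => rfl
  have hMs : IsSelfAdjoint M := by
    refine CStarMatrix.ext fun i j => ?_
    rw [CStarMatrix.star_apply, hM, hM, hH]
  obtain ⟨N, s, hNs, hs, hcube, hsqrt⟩ := exists_negPart hMs
  -- Testing positivity on the columns of `N` makes the diagonal of `N M N` positive, while `N M N =
  -- -(sN)⋆(sN)` makes it negative.
  have hR : s * N = 0 := by
    refine CStarMatrix.ext fun k j => ?_
    obtain ⟨b, hb⟩ := hpos (fun i => N i j)
    have h2 : ∑ i, ∑ l, star (N i j) * H i l * N l j = (N * M * N) j j := by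
      simp only [CStarMatrix.mul_apply, Finset.sum_mul]
      rw [Finset.sum_comm]
      refine Finset.sum_congr rfl fun l _ => Finset.sum_congr rfl fun i _ => ?_
      rw [← CStarMatrix.star_apply, hNs, hM]
    have h3 : (star (s * N) * (s * N)) j j = ∑ i, star ((s * N) i j) * (s * N) i j := by
      rw [CStarMatrix.mul_apply]
      rfl
    rw [h2, hcube, CStarMatrix.neg_apply, h3, map_neg, map_sum] at hb
    -- The extra index `none` carries `b`, so that `b⋆b` and the column of `sN` form one vanishing
    -- sum of squares.
    have h4 : ∑ o : Option ι, star (o.elim b fun i => φ ((s * N) i j)) *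
        (o.elim b fun i => φ ((s * N) i j)) = 0 := by
      rw [Fintype.sum_option]
      simp only [Option.elim, ← map_star, ← map_mul]
      simp only [← hb, neg_add_cancel]
    have h5 := eq_zero_of_sum_star_mul_self_eq_zero h4 (some k)
    exact hφ (by simpa using h5)
  have hN : N = 0 := by
    rw [← CStarRing.star_mul_self_eq_zero_iff, hNs]
    nth_rewrite 1 [hs]
    rw [mul_assoc, hR, mul_zero]
  obtain ⟨t, ht⟩ := hsqrt hN
  refine ⟨fun i k => star (t k i), fun i j => ?_⟩
  rw [← hM, ht, CStarMatrix.mul_apply]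
  simp only [CStarMatrix.star_apply, star_star]

end Positivity

/-! ### Simple C⋆-algebras -/

section Simple

variable {A : Type*} [CStarAlgebra A]

/-- A unital C⋆-algebra without nontrivial closed ideals has no nontrivial ideals at all. -/
theorem IsSimpleCStar.isSimpleRing (hA : IsSimpleCStar A) : IsSimpleRing A := by
  refine isSimpleRing_iff_isTwoSided_imp.2 ⟨hA.1, fun I hI => ?_⟩
  let J : TwoSidedIdeal A := TwoSidedIdeal.mk' (closure (I : Set A)) (subset_closure I.zero_mem)
    (fun {x y} hx hy => I.closure.add_mem hx hy) (fun {x} hx => I.closure.neg_mem hx)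
    (fun {x y} hy => I.closure.mul_mem_left x hy)
    (fun {x y} hx => map_mem_closure (f := fun z => z * y) (by fun_prop) hx
      fun z hz => I.mul_mem_right y hz)
  have hJ : (J : Set A) = closure (I : Set A) := TwoSidedIdeal.coe_mk' ..
  rcases hA.2 J (hJ ▸ isClosed_closure) with h | h
  · left
    rw [eq_bot_iff]
    intro x hx
    have hxJ : x ∈ (J : Set A) := hJ ▸ subset_closure hx
    rw [h] at hxJ
    exact hxJ
  · right
    -- The closure of a proper ideal is proper, because the units form an open set.
    by_contra hI'
    refine I.closure_ne_top hI' ((Ideal.eq_top_iff_one _).2 ?_)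
    have h1 : (1 : A) ∈ (J : Set A) := by rw [h]; trivial
    rwa [hJ] at h1

/-- The center of a simple ring is a field, so for `c` in the spectrum of `z` the central element `c
- z`, not being invertible, is zero. -/
theorem IsSimpleCStar.exists_algebraMap_eq (hA : IsSimpleCStar A) {z : A}
    (hz : z ∈ Set.center A) : ∃ c : ℂ, algebraMap ℂ A c = z := by
  have := hA.1
  have := hA.isSimpleRing
  obtain ⟨c, hc⟩ := spectrum.nonempty z
  refine ⟨c, ?_⟩
  by_contra hne
  have hmem : algebraMap ℂ A c - z ∈ Subring.center A :=
    sub_mem (Subring.mem_center_iff.2 fun g => (Algebra.commutes c g).symm) hz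
  obtain ⟨b, hb⟩ := (IsSimpleRing.isField_center A).mul_inv_cancel (a := ⟨_, hmem⟩)
    (fun h => hne (sub_eq_zero.1 (congrArg Subtype.val h)))
  have hb' := congrArg Subtype.val hb
  refine hc ⟨⟨_, b, hb', ?_⟩, rfl⟩
  exact (Subring.mem_center_iff.1 hmem b).trans hb'

end Simple

/-! ### Quasi-bases of conditional expectations -/

namespace ConditionalExpectation

variable {A : Type*} [CStarAlgebra A] {P : StarSubalgebra ℂ A} (E : ConditionalExpectation P)

theorem isSelfAdjoint_map {a : A} (ha : IsSelfAdjoint a) : IsSelfAdjoint (E a) := by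
  have hsq : ∀ c : A, IsSelfAdjoint (E (star c * c)) := fun c => by
    obtain ⟨b, hb⟩ := E.map_nonneg c
    rw [hb]
    exact IsSelfAdjoint.star_mul_self b
  have h : a = (4⁻¹ : ℝ) • (star (a + 1) * (a + 1) - star (a - 1) * (a - 1)) := by
    rw [star_add, star_sub, star_one, ha.star_eq]
    have : (a + 1) * (a + 1) - (a - 1) * (a - 1) = (4 : ℝ) • a := by
      rw [show (4 : ℝ) = 1 + 1 + 1 + 1 by norm_num]
      simp only [add_smul, one_smul]
      noncomm_ring
    rw [this, smul_smul]
    norm_num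
  rw [h, ← Complex.coe_smul, map_smul, Complex.coe_smul, map_sub]
  exact IsSelfAdjoint.smul (IsSelfAdjoint.all _) ((hsq _).sub (hsq _))

theorem map_star (a : A) : E (star a) = star (E a) := by
  have h := realPart_add_I_smul_imaginaryPart a
  have hr := (E.isSelfAdjoint_map (realPart a).2).star_eq
  have hi := (E.isSelfAdjoint_map (imaginaryPart a).2).star_eq
  rw [← h]
  simp only [star_add, star_smul, map_add, map_smul, hr, hi, (realPart a).2.star_eq,
    (imaginaryPart a).2.star_eq]

variable {E}

/-- A conditional expectation of finite index has a quasi-basis of the form `{(wᵢ, wᵢ⋆)}`. -/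
theorem IsQuasiBasis.exists_star (hP : IsClosed (P : Set A)) {n : ℕ} {u v : Fin n → A}
    (h : E.IsQuasiBasis u v) : ∃ w : Fin n → A, E.IsQuasiBasis w (fun i => star (w i)) := by
  -- Closedness makes `P` a C⋆-algebra, over which the matrix `E(vᵢ vⱼ⋆)` can be factored as `K K⋆`;
  -- the new basis is `wₖ = ∑ uᵢ Kᵢₖ`.
  have := hP
  obtain ⟨K, hK⟩ := exists_eq_sum_mul_star P.subtype Subtype.coe_injective
    (fun i j => (⟨E (v i * star (v j)), E.map_mem _⟩ : P))
    (fun i j => Subtype.ext (by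
      change star (E _) = E _
      rw [← E.map_star, star_mul, star_star]))
    (fun x => by
      -- By bimodularity the quadratic form of the matrix at `x` is `E(y⋆y)` with `y = ∑ vⱼ⋆ xⱼ`.
      obtain ⟨b, hb⟩ := E.map_nonneg (∑ j, star (v j) * x j)
      refine ⟨b, hb ▸ ?_⟩
      simp only [star_sum, star_mul, star_star, Finset.sum_mul, Finset.mul_sum, map_sum]
      rw [Finset.sum_comm]
      refine Finset.sum_congr rfl fun i _ => Finset.sum_congr rfl fun j _ => ?_
      change star (x j : A) * E (v j * star (v i)) * x i = _
      rw [mul_assoc, ← E.map_mul_right _ (x i).2, ← E.map_mul_left _ (star_mem (x j).2)]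
      simp only [mul_assoc])
  have hK' : ∀ i j, E (v i * star (v j)) = ∑ k, (K i k : A) * star (K j k : A) := fun i j => by
    have := congrArg Subtype.val (hK i j)
    simpa using this
  have key : ∀ a, a = ∑ k, (∑ i, u i * K i k) * E (star (∑ j, u j * K j k) * a) := fun a => by
    have h1 : ∀ a, a = ∑ j, star (v j) * E (star (u j) * a) := fun a => by
      have := congrArg star (h (star a)).2
      simpa only [star_star, star_sum, star_mul, ← E.map_star] using this
    have h2 : ∀ k, E (star (∑ j, u j * K j k) * a) =
        ∑ j, star (K j k : A) * E (star (u j) * a) := fun k => by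
      simp only [star_sum, star_mul, Finset.sum_mul, map_sum, mul_assoc]
      exact Finset.sum_congr rfl fun j _ => E.map_mul_left _ (star_mem (K j k).2) _
    calc a = ∑ j, star (v j) * E (star (u j) * a) := h1 a
      _ = ∑ j, (∑ i, u i * ∑ k, (K i k : A) * star (K j k : A)) * E (star (u j) * a) := by
        refine Finset.sum_congr rfl fun j _ => ?_
        simp only [← hK', ← (h (star (v j))).1]
      _ = ∑ k, (∑ i, u i * K i k) * ∑ j, star (K j k : A) * E (star (u j) * a) := by
        simp only [Finset.sum_mul, Finset.mul_sum, mul_assoc]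
        rw [Finset.sum_comm_cycle]
      _ = _ := by simp only [h2]
  refine ⟨fun k => ∑ i, u i * K i k, fun a => ⟨key a, ?_⟩⟩
  have := congrArg star (key (star a))
  simpa only [star_star, star_sum (s := Finset.univ) (f := fun k => _ * E _),
    star_mul (_ : A) (E _), ← E.map_star, star_mul _ (star a)] using this

theorem IsQuasiBasis.sum_mem_center {n : ℕ} {u v : Fin n → A} (h : E.IsQuasiBasis u v) :
    ∑ i, u i * v i ∈ Set.center A := by
  rw [Semigroup.mem_center_iff]
  intro a
  calc a * ∑ i, u i * v i = ∑ i, (∑ j, u j * E (v j * (a * u i))) * v i := by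
        simp only [← (h _).1, Finset.mul_sum, mul_assoc]
    _ = ∑ j, u j * ∑ i, E (v j * a * u i) * v i := by
        simp only [Finset.mul_sum, Finset.sum_mul, mul_assoc]
        exact Finset.sum_comm
    _ = (∑ i, u i * v i) * a := by
        rw [Finset.sum_mul]
        refine Finset.sum_congr rfl fun j _ => ?_
        rw [mul_assoc, ← (h (v j * a)).2]

end ConditionalExpectation

/-! ### The sequence algebra -/

section SequenceAlgebra

variable {A : Type*} [CStarAlgebra A]

/-- The embedding `A → A^∞` as a ring homomorphism. -/
def constSeqHom : A →+* SeqAlg A :=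
  (Ideal.Quotient.mk (nullSeq A)).comp
    { toFun := BoundedContinuousFunction.const ℕ
      map_one' := rfl
      map_mul' := fun _ _ => rfl
      map_zero' := rfl
      map_add' := fun _ _ => rfl }

theorem constSeqHom_apply (a : A) : constSeqHom a = constSeq a := rfl

theorem star_constSeqHom (a : A) : star (constSeqHom a) = constSeqHom (star a) := rfl

theorem constSeqHom_algebraMap (c : ℂ) :
    constSeqHom (algebraMap ℂ A c) = c • (1 : SeqAlg A) := by
  rw [Algebra.algebraMap_eq_smul_one]
  rfl

instance : StarModule ℂ (SeqAlg A) where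
  star_smul c x := by
    obtain ⟨a, rfl⟩ := Ideal.Quotient.mk_surjective x
    exact congrArg SeqAlg.mk (star_smul c a)

/-- Checked on representatives, where the square of each norm is bounded by the norm of the sum; no
norm on the quotient is needed. -/
theorem SeqAlg.eq_zero_of_sum_star_mul_self_eq_zero {ι : Type*} [Fintype ι] {c : ι → SeqAlg A}
    (h : ∑ j, star (c j) * c j = 0) (i : ι) : c i = 0 := by
  choose a ha using fun j => Ideal.Quotient.mk_surjective (c j)
  have h1 : SeqAlg.mk (∑ j, star (a j) * a j) = 0 := by
    rw [SeqAlg.mk, map_sum, ← h]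
    exact Finset.sum_congr rfl fun j _ => by rw [map_mul, ha, ← ha j, SeqAlg.star_mk]
  rw [SeqAlg.mk, Ideal.Quotient.eq_zero_iff_mem, mem_nullSeq] at h1
  rw [← ha, Ideal.Quotient.eq_zero_iff_mem, mem_nullSeq]
  have h2 : Tendsto (fun n => ‖a i n‖ ^ 2) atTop (𝓝 0) := by
    refine squeeze_zero (fun n => by positivity) (fun n => ?_) h1
    have := norm_sq_le_norm_sum_star_mul_self (fun j => a j n) i
    simpa using this
  simpa using h2.sqrt

end SequenceAlgebra

/-! ### Module properties of `E^∞` and the identity for the Rohlin projection -/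

namespace ConditionalExpectation

variable {A : Type*} [CStarAlgebra A] {P : StarSubalgebra ℂ A} (E : ConditionalExpectation P)

theorem seq_mk_apply (a : ℕ →ᵇ A) :
    E.seq (SeqAlg.mk a) = SeqAlg.mk (E.toCLM.compLeftContinuousBounded ℕ a) := rfl

theorem seq_seq_mul (x y : SeqAlg A) : E.seq (E.seq x * y) = E.seq x * E.seq y := by
  obtain ⟨a, rfl⟩ := Ideal.Quotient.mk_surjective x
  obtain ⟨b, rfl⟩ := Ideal.Quotient.mk_surjective y
  exact congrArg SeqAlg.mk
    (BoundedContinuousFunction.ext fun n => E.map_mul_left _ (E.map_mem (a n)) (b n))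

theorem seq_mul_seq (x y : SeqAlg A) : E.seq (x * E.seq y) = E.seq x * E.seq y := by
  obtain ⟨a, rfl⟩ := Ideal.Quotient.mk_surjective x
  obtain ⟨b, rfl⟩ := Ideal.Quotient.mk_surjective y
  exact congrArg SeqAlg.mk
    (BoundedContinuousFunction.ext fun n => E.map_mul_right _ (E.map_mem (b n)) (a n))

theorem seq_constSeqHom_mul {p : A} (hp : p ∈ P) (x : SeqAlg A) :
    E.seq (constSeqHom p * x) = constSeqHom p * E.seq x := by
  obtain ⟨a, rfl⟩ := Ideal.Quotient.mk_surjective x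
  exact congrArg SeqAlg.mk (BoundedContinuousFunction.ext fun n => E.map_mul_left p hp (a n))

theorem seq_star (x : SeqAlg A) : E.seq (star x) = star (E.seq x) := by
  obtain ⟨a, rfl⟩ := Ideal.Quotient.mk_surjective x
  exact congrArg SeqAlg.mk (BoundedContinuousFunction.ext fun n => E.map_star (a n))

variable {E}

theorem IsQuasiBasis.seq_eq {n : ℕ} {u v : Fin n → A} (h : E.IsQuasiBasis u v) (x : SeqAlg A) :
    x = ∑ i, constSeqHom (u i) * E.seq (constSeqHom (v i) * x) := by
  obtain ⟨a, rfl⟩ := Ideal.Quotient.mk_surjective x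
  have : a = ∑ i, BoundedContinuousFunction.const ℕ (u i) *
      E.toCLM.compLeftContinuousBounded ℕ (BoundedContinuousFunction.const ℕ (v i) * a) := by
    ext n
    rw [BoundedContinuousFunction.sum_apply]
    exact (h (a n)).1
  conv_lhs => rw [this, map_sum]
  rfl

/-- An element of `P'` commutes with the image of `E^∞`. -/
theorem constSeqHom_mul_seq_comm {x : A} (hx : x ∈ Set.centralizer (P : Set A)) (y : SeqAlg A) :
    constSeqHom x * E.seq y = E.seq y * constSeqHom x := by
  obtain ⟨a, rfl⟩ := Ideal.Quotient.mk_surjective y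
  exact congrArg SeqAlg.mk (BoundedContinuousFunction.ext fun n => (hx _ (E.map_mem (a n))).symm)

/-- If `e` is a Rohlin projection and `Index E` is the scalar `c`, then
`e x = c e E^∞(e x)` for all `x ∈ A^∞`. -/
theorem IsQuasiBasis.proj_mul_eq {n : ℕ} {w : Fin n → A}
    (h : E.IsQuasiBasis w (fun i => star (w i))) {c : ℂ} (hc : c ≠ 0)
    (hw : ∑ i, w i * star (w i) = algebraMap ℂ A c) {e : SeqAlg A} (he : IsStarProjection e)
    (hEe : E.seq e = c⁻¹ • (1 : SeqAlg A)) (x : SeqAlg A) :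
    e * x = c • (e * E.seq (e * x)) := by
  have hee : e * e = e := he.isIdempotentElem
  have hes : star e = e := he.isSelfAdjoint
  have key : ∀ i, e * constSeqHom (w i) = c • (e * E.seq (e * constSeqHom (w i))) := by
    intro i
    -- With `star c` here, the sums are `c e`, `c̄ e`, `c e` and `c̄ e`, and cancel without knowing
    -- that `c` is real.
    set d : Fin n → SeqAlg A := fun i =>
      constSeqHom (star (w i)) * e - star c • (E.seq (constSeqHom (star (w i)) * e) * e) with hd
    have hds : ∀ i, star (d i) =
        e * constSeqHom (w i) - c • (e * E.seq (e * constSeqHom (w i))) := fun i => by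
      simp only [hd, star_sub, star_mul, star_smul, hes, star_constSeqHom, star_star, ← seq_star]
    have hq : ∑ i, constSeqHom (w i) * E.seq (constSeqHom (star (w i)) * e) = e :=
      (h.seq_eq e).symm
    have hq' : ∑ i, E.seq (e * constSeqHom (w i)) * constSeqHom (star (w i)) = e := by
      have := congrArg star hq
      simpa only [star_sum, star_mul, ← seq_star, star_constSeqHom, star_star, hes] using this
    have h1 : ∑ i, e * constSeqHom (w i) * (constSeqHom (star (w i)) * e) = c • e := by
      calc _ = e * (∑ i, constSeqHom (w i) * constSeqHom (star (w i))) * e := by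
            simp only [Finset.mul_sum, Finset.sum_mul, mul_assoc]
        _ = c • e := by
            simp only [← map_mul, ← map_sum, hw, constSeqHom_algebraMap, mul_smul_comm,
              smul_mul_assoc, mul_one, hee]
    have h2 : ∑ i, e * constSeqHom (w i) * (E.seq (constSeqHom (star (w i)) * e) * e) = e := by
      calc _ = e * (∑ i, constSeqHom (w i) * E.seq (constSeqHom (star (w i)) * e)) * e := by
            simp only [Finset.mul_sum, Finset.sum_mul, mul_assoc]
        _ = e := by rw [hq, hee, hee]
    have h3 : ∑ i, e * E.seq (e * constSeqHom (w i)) * (constSeqHom (star (w i)) * e) = e := by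
      calc _ = e * (∑ i, E.seq (e * constSeqHom (w i)) * constSeqHom (star (w i))) * e := by
            simp only [Finset.mul_sum, Finset.sum_mul, mul_assoc]
        _ = e := by rw [hq', hee, hee]
    have h4 : ∑ i, e * E.seq (e * constSeqHom (w i)) *
        (E.seq (constSeqHom (star (w i)) * e) * e) = c⁻¹ • e := by
      calc _ = e * E.seq (e * ∑ i, constSeqHom (w i) *
              E.seq (constSeqHom (star (w i)) * e)) * e := by
            simp only [Finset.mul_sum, Finset.sum_mul, map_sum, ← mul_assoc, seq_mul_seq]
        _ = c⁻¹ • e := by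
            rw [hq, hee, hEe, mul_smul_comm, smul_mul_assoc, mul_one, hee]
    have hsum : ∑ i, star (d i) * d i = 0 := by
      simp only [hds]
      simp only [hd, sub_mul, mul_sub, smul_mul_assoc, mul_smul_comm, Finset.sum_sub_distrib,
        ← Finset.smul_sum, h1, h2, h3, h4, smul_smul]
      rw [mul_inv_cancel₀ hc, one_smul, sub_self, sub_self, smul_zero, sub_zero]
    have hdi := SeqAlg.eq_zero_of_sum_star_mul_self_eq_zero hsum i
    have := congrArg star hdi
    rwa [hds, star_zero, sub_eq_zero] at this
  -- Both sides are right linear over the range of `E^∞`, so expanding `x` in the quasi-basis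
  -- reduces to the case `x = wᵢ`.
  conv_lhs => rw [h.seq_eq x, Finset.mul_sum]
  conv_rhs => rw [h.seq_eq x, Finset.mul_sum, map_sum, Finset.mul_sum, Finset.smul_sum]
  refine Finset.sum_congr rfl fun i _ => ?_
  rw [← mul_assoc, seq_mul_seq]
  nth_rewrite 1 [key]
  rw [smul_mul_assoc, mul_assoc]

end ConditionalExpectation

/-! ### The homomorphism `A → P^∞` given by a Rohlin projection -/

namespace ConditionalExpectation

variable {A : Type*} [CStarAlgebra A] {P : StarSubalgebra ℂ A} (E : ConditionalExpectation P)

/-- The map `x ↦ c E^∞(x e)`; for a Rohlin projection `e` and `c = Index E`, it is a homomorphism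
from `A` to `P^∞` which restricts to the canonical embedding of `P`. -/
def rohlinMap (c : ℂ) (e : SeqAlg A) (x : A) : SeqAlg A := c • E.seq (constSeqHom x * e)

theorem rohlinMap_eq_seq (c : ℂ) (e : SeqAlg A) (x : A) :
    E.rohlinMap c e x = E.seq (c • (constSeqHom x * e)) := (map_smul _ _ _).symm

theorem rohlinMap_add (c : ℂ) (e : SeqAlg A) (x y : A) :
    E.rohlinMap c e (x + y) = E.rohlinMap c e x + E.rohlinMap c e y := by
  simp only [rohlinMap, map_add, add_mul, smul_add]

theorem rohlinMap_neg (c : ℂ) (e : SeqAlg A) (x : A) :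
    E.rohlinMap c e (-x) = -E.rohlinMap c e x := by
  simp only [rohlinMap, map_neg, neg_mul, smul_neg]

theorem rohlinMap_of_mem {c : ℂ} (hc : c ≠ 0) {e : SeqAlg A}
    (hEe : E.seq e = c⁻¹ • (1 : SeqAlg A)) {p : A} (hp : p ∈ P) :
    E.rohlinMap c e p = constSeqHom p := by
  rw [rohlinMap, seq_constSeqHom_mul _ hp, hEe, mul_smul_comm, mul_one, smul_smul,
    mul_inv_cancel₀ hc, one_smul]

/-- The data extracted from the Rohlin property when `Index E` is a scalar `c`. -/
structure IsScalarRohlinProjection (c : ℂ) (e : SeqAlg A) : Prop where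
  ne_zero : c ≠ 0
  comm : ∀ a, constSeqHom a * e = e * constSeqHom a
  seq_eq : E.seq e = c⁻¹ • (1 : SeqAlg A)
  mul_eq : ∀ x, e * x = c • (e * E.seq (e * x))
  injective : Function.Injective fun x : A => constSeqHom x * e

variable {E}

/-- For a simple `A`, the index is a scalar. -/
theorem HasRohlinProperty.exists_isScalarRohlinProjection (hP : IsClosed (P : Set A))
    (hA : IsSimpleCStar A) {hfin : E.FiniteIndex} (hE : E.HasRohlinProperty hfin) :
    ∃ (c : ℂ) (e : SeqAlg A), E.IsScalarRohlinProjection c e := by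
  have := hA.1
  obtain ⟨e, hcent, he, ⟨g, hg, hEe⟩, hinj⟩ := hE
  obtain ⟨n, u, v, huv⟩ := id hfin
  obtain ⟨w, hw⟩ := huv.exists_star hP
  obtain ⟨c, hcw⟩ := hA.exists_algebraMap_eq hw.sum_mem_center
  -- Independence of the quasi-basis lets the index be computed with `(wᵢ, wᵢ⋆)`.
  rw [index_eq hfin hw, ← hcw] at hg
  have hc : c ≠ 0 := by
    rintro rfl
    rw [map_zero] at hg
    exact g.ne_zero hg
  have hginv : ((g⁻¹ : Aˣ) : A) = algebraMap ℂ A c⁻¹ := by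
    exact Units.inv_eq_of_mul_eq_one_right (by rw [hg, ← map_mul, mul_inv_cancel₀ hc, map_one])
  have hEe' : E.seq e = c⁻¹ • (1 : SeqAlg A) := by
    rw [hEe, hginv, ← constSeqHom_apply, constSeqHom_algebraMap]
  exact ⟨c, e, hc, fun a => hcent _ ⟨a, rfl⟩, hEe', hw.proj_mul_eq hc hcw.symm he hEe', hinj⟩

namespace IsScalarRohlinProjection

variable {c : ℂ} {e : SeqAlg A}

theorem proj_mul_constSeqHom (h : E.IsScalarRohlinProjection c e) (x : A) :
    e * constSeqHom x = e * E.rohlinMap c e x := by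
  rw [rohlinMap, h.comm, mul_smul_comm, ← h.mul_eq]

/-- Moving `e` past constants gives `x y e = e ρ(x) ρ(y)`. Applying `c E^∞` removes `e`, since `ρ(x)
ρ(y)` lies in the range of `E^∞` and `E^∞(e) = c⁻¹`. -/
theorem rohlinMap_mul (h : E.IsScalarRohlinProjection c e) (x y : A) :
    E.rohlinMap c e (x * y) = E.rohlinMap c e x * E.rohlinMap c e y := by
  have h1 : constSeqHom (x * y) * e = e * (E.rohlinMap c e x * E.rohlinMap c e y) := by
    rw [h.comm, map_mul, ← mul_assoc, ← h.comm, mul_assoc, h.proj_mul_constSeqHom y, ← mul_assoc,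
      h.comm, h.proj_mul_constSeqHom x, mul_assoc]
  rw [rohlinMap, h1, E.rohlinMap_eq_seq c e x, E.rohlinMap_eq_seq c e y, ← seq_mul_seq, seq_mul_seq,
    h.seq_eq, smul_mul_assoc, one_mul, smul_smul, mul_inv_cancel₀ h.ne_zero, one_smul]

/-- Elements of `A` which commute with `P` are central. -/
theorem centralizer_subset_center (h : E.IsScalarRohlinProjection c e) :
    Set.centralizer (P : Set A) ⊆ Set.center A := by
  intro x hx
  rw [Semigroup.mem_center_iff]
  intro a
  refine h.injective ?_
  change constSeqHom (a * x) * e = constSeqHom (x * a) * e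
  have hcomm : E.rohlinMap c e a * constSeqHom x = constSeqHom x * E.rohlinMap c e a := by
    rw [E.rohlinMap_eq_seq, constSeqHom_mul_seq_comm hx]
  rw [h.comm, map_mul, ← mul_assoc, h.proj_mul_constSeqHom, mul_assoc, hcomm, ← mul_assoc,
    ← h.comm, mul_assoc, ← h.proj_mul_constSeqHom, map_mul, mul_assoc, h.comm]

theorem isSimpleCStar (h : E.IsScalarRohlinProjection c e) (hA : IsSimpleCStar A) :
    IsSimpleCStar P := by
  have := hA.1
  have := hA.isSimpleRing
  refine ⟨inferInstance, fun I hI => or_iff_not_imp_left.2 fun hne => ?_⟩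
  obtain ⟨p, hp, hp0⟩ : ∃ p ∈ I, p ≠ 0 := by
    by_contra! hcon
    exact hne (le_bot_iff.1 fun x hx => (TwoSidedIdeal.mem_bot _).2 (hcon x hx))
  -- `N` stands for the image of bounded sequences in `I`; it absorbs only factors from the range of
  -- `E^∞`, which suffices because `ρ` takes values there.
  let N : SeqAlg A → Prop := fun y => ∃ s : ℕ →ᵇ A, SeqAlg.mk s = y ∧ ∀ n, ∃ q ∈ I, (q : A) = s n
  have hmul_left : ∀ x y, N y → N (E.seq x * y) := by
    rintro x _ ⟨s, rfl, hs⟩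
    obtain ⟨a, rfl⟩ := Ideal.Quotient.mk_surjective x
    refine ⟨E.toCLM.compLeftContinuousBounded ℕ a * s, rfl, fun n => ?_⟩
    obtain ⟨q, hq, hqs⟩ := hs n
    exact ⟨⟨E (a n), E.map_mem _⟩ * q, I.mul_mem_left _ _ hq, by simp [hqs]⟩
  have hmul_right : ∀ x y, N y → N (y * E.seq x) := by
    rintro x _ ⟨s, rfl, hs⟩
    obtain ⟨a, rfl⟩ := Ideal.Quotient.mk_surjective x
    refine ⟨s * E.toCLM.compLeftContinuousBounded ℕ a, rfl, fun n => ?_⟩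
    obtain ⟨q, hq, hqs⟩ := hs n
    exact ⟨q * ⟨E (a n), E.map_mem _⟩, I.mul_mem_right _ _ hq, by simp [hqs]⟩
  let J : TwoSidedIdeal A := TwoSidedIdeal.mk' {x | N (E.rohlinMap c e x)}
    ⟨0, by simp [rohlinMap], fun _ => ⟨0, I.zero_mem, rfl⟩⟩
    (by
      rintro x y ⟨s, hs, hsI⟩ ⟨t, ht, htI⟩
      refine ⟨s + t, by rw [rohlinMap_add, ← hs, ← ht, ← map_add], fun n => ?_⟩
      obtain ⟨q, hq, hqs⟩ := hsI n
      obtain ⟨r, hr, hrt⟩ := htI n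
      exact ⟨q + r, I.add_mem hq hr, by simp [hqs, hrt]⟩)
    (by
      rintro x ⟨s, hs, hsI⟩
      refine ⟨-s, by rw [rohlinMap_neg, ← hs, ← map_neg], fun n => ?_⟩
      obtain ⟨q, hq, hqs⟩ := hsI n
      exact ⟨-q, I.neg_mem hq, by simp [hqs]⟩)
    (by
      intro x y hy
      rw [Set.mem_ofPred_eq, h.rohlinMap_mul, E.rohlinMap_eq_seq c e x]
      exact hmul_left _ _ hy)
    (by
      intro x y hx
      rw [Set.mem_ofPred_eq, h.rohlinMap_mul, E.rohlinMap_eq_seq c e y]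
      exact hmul_right _ _ hx)
  have hpJ : (p : A) ∈ J := by
    refine (TwoSidedIdeal.mem_mk' ..).2 ?_
    exact ⟨BoundedContinuousFunction.const ℕ (p : A),
      (E.rohlinMap_of_mem h.ne_zero h.seq_eq p.2).symm, fun _ => ⟨p, hp, rfl⟩⟩
  -- `J` is not shown to be closed: `A` is simple as a ring.
  have h1 : (1 : A) ∈ J :=
    IsSimpleRing.one_mem_of_ne_zero_mem J (x := (p : A)) (by simpa using hp0) hpJ
  obtain ⟨s, hs, hsI⟩ : N (E.rohlinMap c e 1) := by
    have h2 := h1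
    rw [← SetLike.mem_coe, TwoSidedIdeal.coe_mk'] at h2
    exact h2
  rw [E.rohlinMap_of_mem h.ne_zero h.seq_eq (one_mem P)] at hs
  have hlim : Tendsto s atTop (𝓝 1) := by
    have hs' := (Ideal.Quotient.mk_eq_mk_iff_sub_mem _ _).1 hs
    rw [mem_nullSeq, ← tendsto_zero_iff_norm_tendsto_zero] at hs'
    exact tendsto_sub_nhds_zero_iff.1 hs'
  choose q hq hqs using hsI
  have hqlim : Tendsto q atTop (𝓝 1) := by
    rw [tendsto_subtype_rng]
    simp only [hqs]
    exact hlim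
  exact (TwoSidedIdeal.one_mem_iff I).1
    (hI.mem_of_tendsto hqlim (Eventually.of_forall hq))

end IsScalarRohlinProjection

end ConditionalExpectation

end CStarInclusion

end

theorem mainTheorem8 {A : Type*} [CStarAlgebra A] (P : StarSubalgebra ℂ A)
    (hP : IsClosed (P : Set A)) (E : CStarInclusion.ConditionalExpectation P)
    (hfin : E.FiniteIndex) (hE : E.HasRohlinProperty hfin) (hA : CStarInclusion.IsSimpleCStar A) :
    CStarInclusion.IsIrreducibleInclusion P ∧ CStarInclusion.IsSimpleCStar P := by
  obtain ⟨c, e, h⟩ := hE.exists_isScalarRohlinProjection hP hA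
  refine ⟨Set.Subset.antisymm (fun x hx => ?_) ?_, h.isSimpleCStar hA⟩
  · exact hA.exists_algebraMap_eq (h.centralizer_subset_center hx)
  · rintro _ ⟨z, rfl⟩ p _
    exact (Algebra.commutes z p).symm
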